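/- A hypergraph $H$ is a \emph{Berge triangle} if it has exactly three distinct hyperedges and there are three distinct vertices $x,y,z$ such that the hyperedges can be labelled $e_{xy},e_{yz},e_{xz}$ with $x,y\in e_{xy}$, $y,z\in e_{yz}$ and $x,z\in e_{xz}$. Let $\mathcal F=\mathcal B(K_3)$ be the family of all Berge triangles. For $k\ge 2$ let $R_3(\mathcal F,k)$ be the smallest integer $n$ such that every coloring with $k$ colors of all $3$-element subsets of an $n$-element set contains a monochromatic member of $\mathcal F$. Let $f(n,\mathcal F)$ be the smallest number of colors in a coloring of all subsets of an $n$-element set that contains no monochromatic member of $\mathcal F$. Then: (1) $k/2-o(k)\le R_3(\mathcal F,k)\le 3k/4+o(k)$ as $k\to\infty$. (2) $R_3(\mathcal F,2)=R_3(\mathcal F,3)=5$, $R_3(\mathcal F,4)=6$, $R_3(\mathcal F,5)=7$, $R_3(\mathcal F,6)=8$ and $R_3(\mathcal F,8)=9$. (3) $2^{n-2}(1-o(1))\le f(n,\mathcal F)\le 2^{n-2}$ for all $n\ge 3$, where $o(1)\to 0$ as $n\to\infty$. (4) For odd $n\ge 3$, $f(n,\mathcal F)=2^{n-2}$ holds if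 and only if $n\ne 5$. -/

import Mathlib

open Filter Topology Asymptotics

/-- A hypergraph on the vertex set `V`, given by its set `H` of (distinct) hyperedges, is
*Berge-`G`*: there are an injection `φ` of the vertices of `G` and a bijection `ψ` from the edges
of `G` onto the hyperedges of `H` such that `φ x, φ y ∈ ψ (xy)` for each edge `xy` of `G`. -/
def IsBerge {W V : Type*} (G : SimpleGraph W) (H : Set (Finset V)) : Prop :=
  ∃ φ : W ↪ V, ∃ ψ : G.edgeSet ≃ H,
    ∀ e : G.edgeSet, ∀ x ∈ (e : Sym2 W), φ x ∈ (ψ e : Finset V)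

/-- The coloring `c` of the hyperedges in `E` has a monochromatic Berge-`G` subhypergraph. -/
def HasMonoBerge {W V κ : Type*} (G : SimpleGraph W) (E : Set (Finset V)) (c : E → κ) : Prop :=
  ∃ i : κ, ∃ H : Set (Finset V), IsBerge G H ∧ ∀ e ∈ H, ∃ he : e ∈ E, c ⟨e, he⟩ = i

/-- The hyperedges of the complete `r`-uniform hypergraph on `n` vertices. -/
def completeUniform (r n : ℕ) : Set (Finset (Fin n)) := {e | e.card = r}

/-- The hypergraph of all subsets of an `n`-element set. -/
def allSubsets (n : ℕ) : Set (Finset (Fin n)) := Set.univ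

/-- The Ramsey number `R_r(B(G), k)`: the smallest `n` such that every coloring of the complete
`r`-uniform hypergraph on `n` vertices with `k` colors has a monochromatic Berge-`G`
subhypergraph. -/
noncomputable def bergeRamsey {W : Type*} (r : ℕ) (G : SimpleGraph W) (k : ℕ) : ℕ :=
  sInf {n : ℕ | ∀ c : completeUniform r n → Fin k, HasMonoBerge G (completeUniform r n) c}

/-- The dual function `f(n, B(G))`: the smallest number of colors in a coloring of all subsets of
an `n`-element set without a monochromatic Berge-`G` hypergraph. -/
noncomputable def bergeDual {W : Type*} (n : ℕ) (G : SimpleGraph W) : ℕ :=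
  sInf {m : ℕ | ∃ c : allSubsets n → Fin m, ¬ HasMonoBerge G (allSubsets n) c}

/-- The triangle `K₃`. -/
abbrev triangleGraph : SimpleGraph (Fin 3) := ⊤

/-! A coloring without a monochromatic Berge triangle is a cover by triangle-free families, so both
functions are covering numbers.

Ramsey side: a triangle-free family of triples on `n` points has at most `n²/8` members
(`TriFree.eight_mul_card_le`). Each triple has two pairs at one of its vertices that lie in no other
triple, and all these private pairs form a triangle-free graph, to which Mantel's theorem applies.
Counting triples then gives the upper bounds. Covers come from repeatedly halving the vertex set
(`triCover_triples`) and, for small `n`, from explicit lists.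

Dual side: for `n ≥ 6` any three distinct sets with more than `n/2` elements form a Berge triangle
(`bergeTri_of_large`), so a class holds at most two of them. About half of all subsets are that
large, exactly half for odd `n`, which forces about `2^(n-2)` classes. Conversely, two complementary
pairs can always share a class (`triCover_allSubsets`). For `n = 5` an explicit cover with seven
classes beats this. -/

/-- Three distinct hyperedges whose pairwise intersections have distinct representatives. -/
def BergeTri {V : Type*} (A B C : Finset V) : Prop :=
  A ≠ B ∧ B ≠ C ∧ A ≠ C ∧ ∃ x y z : V, x ≠ y ∧ y ≠ z ∧ x ≠ z ∧
    (x ∈ A ∧ x ∈ B) ∧ (y ∈ B ∧ y ∈ C) ∧ (z ∈ A ∧ z ∈ C)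

/-- A family of hyperedges without a Berge triangle. -/
def TriFree {V : Type*} (S : Set (Finset V)) : Prop :=
  ∀ A ∈ S, ∀ B ∈ S, ∀ C ∈ S, ¬ BergeTri A B C

/-- The hyperedges in `E` are covered by `k` families without Berge triangles. -/
def TriCover {V : Type*} (E : Set (Finset V)) (k : ℕ) : Prop :=
  ∃ P : Fin k → Set (Finset V), (∀ i, TriFree (P i)) ∧ ∀ e ∈ E, ∃ i, e ∈ P i

/-! ### Colorings as covers by triangle-free families -/

theorem BergeTri.isBerge {V : Type*} {A B C : Finset V} (h : BergeTri A B C) :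
    IsBerge triangleGraph ({A, B, C} : Set (Finset V)) := by
  classical
  obtain ⟨hAB, hBC, hAC, x, y, z, hxy, hyz, hxz, hx, hy, hz⟩ := h
  -- An edge of `K₃` is recognized by the vertex it misses. The vertices `0, 1, 2` will go to `z, x,
  -- y`.
  let f : triangleGraph.edgeSet → ({A, B, C} : Set (Finset V)) := fun e =>
    if (0 : Fin 3) ∉ (e : Sym2 (Fin 3)) then ⟨B, by simp⟩
    else if (1 : Fin 3) ∉ (e : Sym2 (Fin 3)) then ⟨C, by simp⟩ else ⟨A, by simp⟩
  have e01 : s(0, 1) ∈ triangleGraph.edgeSet := by simp [triangleGraph]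
  have e12 : s(1, 2) ∈ triangleGraph.edgeSet := by simp [triangleGraph]
  have e02 : s(0, 2) ∈ triangleGraph.edgeSet := by simp [triangleGraph]
  have cases3 : ∀ e : triangleGraph.edgeSet, e = ⟨_, e01⟩ ∨ e = ⟨_, e12⟩ ∨ e = ⟨_, e02⟩ := by
    rintro ⟨e, he⟩
    induction e using Sym2.ind with
    | _ a b =>
      simp only [Subtype.mk.injEq]
      fin_cases a <;> fin_cases b <;> simp [triangleGraph] at he ⊢
  have f01 : f ⟨_, e01⟩ = ⟨A, by simp⟩ := by simp [f]
  have f12 : f ⟨_, e12⟩ = ⟨B, by simp⟩ := by simp [f]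
  have f02 : f ⟨_, e02⟩ = ⟨C, by simp⟩ := by simp [f]
  have hf : Function.Bijective f := by
    constructor
    · intro e e' hee
      have key : ∀ D : Finset V, (f e : Finset V) = D → (f e' : Finset V) = D := fun D h => hee ▸ h
      rcases cases3 e with rfl | rfl | rfl <;> rcases cases3 e' with rfl | rfl | rfl <;>
        first
        | rfl
        | (have h := key _ rfl
           simp only [f01, f12, f02] at h
           first
           | exact absurd h hAB | exact absurd h hBC | exact absurd h hAC
           | exact absurd h.symm hAB | exact absurd h.symm hBC | exact absurd h.symm hAC)
    · rintro ⟨D, hD⟩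
      rcases hD with rfl | rfl | rfl
      exacts [⟨_, f01⟩, ⟨_, f12⟩, ⟨_, f02⟩]
  refine ⟨⟨![z, x, y], ?_⟩, Equiv.ofBijective f hf, ?_⟩
  · intro i j hij
    fin_cases i <;> fin_cases j <;> simp_all
  · intro e v hv
    rw [Equiv.ofBijective_apply]
    rcases cases3 e with rfl | rfl | rfl
    · rw [f01]
      rcases Sym2.mem_iff.1 hv with rfl | rfl
      exacts [hz.1, hx.1]
    · rw [f12]
      rcases Sym2.mem_iff.1 hv with rfl | rfl
      exacts [hx.2, hy.1]
    · rw [f02]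
      rcases Sym2.mem_iff.1 hv with rfl | rfl
      exacts [hz.2, hy.2]

theorem IsBerge.exists_bergeTri {V : Type*} {H : Set (Finset V)}
    (h : IsBerge triangleGraph H) : ∃ A ∈ H, ∃ B ∈ H, ∃ C ∈ H, BergeTri A B C := by
  obtain ⟨φ, ψ, h⟩ := h
  have e01 : s(0, 1) ∈ triangleGraph.edgeSet := by simp [triangleGraph]
  have e12 : s(1, 2) ∈ triangleGraph.edgeSet := by simp [triangleGraph]
  have e02 : s(0, 2) ∈ triangleGraph.edgeSet := by simp [triangleGraph]
  have hne : ∀ {e e' : Sym2 (Fin 3)} (he : e ∈ triangleGraph.edgeSet)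
      (he' : e' ∈ triangleGraph.edgeSet), e ≠ e' →
      ((ψ ⟨e, he⟩ : H) : Finset V) ≠ (ψ ⟨e', he'⟩ : H) := by
    intro e e' he he' hn heq
    exact hn (congrArg Subtype.val (ψ.injective (Subtype.ext heq)))
  refine ⟨_, (ψ ⟨_, e01⟩).2, _, (ψ ⟨_, e12⟩).2, _, (ψ ⟨_, e02⟩).2,
    hne _ _ (by decide), hne _ _ (by decide), hne _ _ (by decide), φ 1, φ 2, φ 0,
    φ.injective.ne (by decide), φ.injective.ne (by decide), φ.injective.ne (by decide),
    ⟨h _ _ ?_, h _ _ ?_⟩, ⟨h _ _ ?_, h _ _ ?_⟩, ⟨h _ _ ?_, h _ _ ?_⟩⟩ <;> simp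

/-- The families of a cover may overlap and may contain sets outside `E`; choosing one family for
each hyperedge recovers a coloring. -/
theorem exists_not_hasMonoBerge_iff {V : Type*} {E : Set (Finset V)} {k : ℕ} :
    (∃ c : E → Fin k, ¬ HasMonoBerge triangleGraph E c) ↔ TriCover E k := by
  constructor
  · rintro ⟨c, hc⟩
    refine ⟨fun i => {e | ∃ he : e ∈ E, c ⟨e, he⟩ = i}, ?_, fun e he => ⟨c ⟨e, he⟩, he, rfl⟩⟩
    intro i A hA B hB C hC hT
    refine hc ⟨i, _, hT.isBerge, ?_⟩
    rintro e (rfl | rfl | rfl)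
    exacts [hA, hB, hC]
  · rintro ⟨P, hP, hE⟩
    choose f hf using hE
    refine ⟨fun e => f e.1 e.2, ?_⟩
    rintro ⟨i, H, hH, hm⟩
    obtain ⟨A, hA, B, hB, C, hC, hT⟩ := hH.exists_bergeTri
    have key : ∀ e ∈ H, e ∈ P i := by
      intro e he
      obtain ⟨h1, h2⟩ := hm e he
      exact h2 ▸ hf e h1
    exact hP i A (key A hA) B (key B hB) C (key C hC) hT

theorem TriFree.empty {V : Type*} : TriFree (∅ : Set (Finset V)) := by
  intro A hA
  exact absurd hA (Set.notMem_empty A)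

theorem TriFree.mono {V : Type*} {S T : Set (Finset V)} (hT : TriFree T) (h : S ⊆ T) :
    TriFree S := fun A hA B hB C hC => hT A (h hA) B (h hB) C (h hC)

theorem TriCover.subset {V : Type*} {E F : Set (Finset V)} {k : ℕ} (hF : TriCover F k)
    (h : E ⊆ F) : TriCover E k := by
  obtain ⟨P, hP, hE⟩ := hF
  exact ⟨P, hP, fun e he => hE e (h he)⟩

theorem TriCover.union {V : Type*} {E F : Set (Finset V)} {k l : ℕ} (hE : TriCover E k)
    (hF : TriCover F l) : TriCover (E ∪ F) (k + l) := by
  obtain ⟨P, hP, hE⟩ := hE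
  obtain ⟨Q, hQ, hF⟩ := hF
  refine ⟨Fin.addCases P Q, ?_, ?_⟩
  · intro i
    refine Fin.addCases (fun i => ?_) (fun i => ?_) i
    · simpa using hP i
    · simpa using hQ i
  · rintro e (he | he)
    · obtain ⟨i, hi⟩ := hE e he
      exact ⟨Fin.castAdd l i, by simpa using hi⟩
    · obtain ⟨i, hi⟩ := hF e he
      exact ⟨Fin.natAdd k i, by simpa using hi⟩

theorem TriCover.empty {V : Type*} (k : ℕ) : TriCover (∅ : Set (Finset V)) k :=
  ⟨fun _ => ∅, fun _ => TriFree.empty, fun e he => absurd he (Set.notMem_empty e)⟩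

theorem TriCover.mono {V : Type*} {E : Set (Finset V)} {k l : ℕ} (hE : TriCover E k)
    (h : k ≤ l) : TriCover E l := by
  obtain ⟨d, rfl⟩ := Nat.exists_eq_add_of_le h
  simpa using hE.union (TriCover.empty d)

theorem BergeTri.map {V W : Type*} (φ : V ↪ W) {A B C : Finset V} (h : BergeTri A B C) :
    BergeTri (A.map φ) (B.map φ) (C.map φ) := by
  obtain ⟨hAB, hBC, hAC, x, y, z, hxy, hyz, hxz, hx, hy, hz⟩ := h
  exact ⟨(Finset.map_injective φ).ne hAB, (Finset.map_injective φ).ne hBC,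
    (Finset.map_injective φ).ne hAC, φ x, φ y, φ z, φ.injective.ne hxy, φ.injective.ne hyz,
    φ.injective.ne hxz, by simpa using hx, by simpa using hy, by simpa using hz⟩

theorem TriCover.comap {V W : Type*} (φ : V ↪ W) {E : Set (Finset V)} {F : Set (Finset W)}
    {k : ℕ} (hF : TriCover F k) (h : ∀ e ∈ E, e.map φ ∈ F) : TriCover E k := by
  obtain ⟨P, hP, hF⟩ := hF
  exact ⟨fun i => {e | e.map φ ∈ P i},
    fun i A hA B hB C hC hT => hP i _ hA _ hB _ hC (hT.map φ), fun e he => hF _ (h e he)⟩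

theorem TriCover.completeUniform_mono {r n n' k : ℕ} (h : TriCover (completeUniform r n') k)
    (hn : n ≤ n') : TriCover (completeUniform r n) k := by
  refine h.comap (Fin.castLEEmb hn) fun e he => ?_
  simpa [completeUniform] using he

theorem bergeRamsey_eq_sInf (r k : ℕ) :
    bergeRamsey r triangleGraph k = sInf {n | ¬ TriCover (completeUniform r n) k} := by
  unfold bergeRamsey
  congr 1
  ext n
  simp only [Set.mem_ofPred_eq, ← exists_not_hasMonoBerge_iff, not_exists, not_not]

theorem bergeDual_eq_sInf (n : ℕ) :
    bergeDual n triangleGraph = sInf {m | TriCover (allSubsets n) m} := by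
  unfold bergeDual
  congr 1
  ext n
  simp only [Set.mem_ofPred_eq, exists_not_hasMonoBerge_iff]

theorem bergeRamsey_le {r n k : ℕ} (h : ¬ TriCover (completeUniform r n) k) :
    bergeRamsey r triangleGraph k ≤ n := by
  rw [bergeRamsey_eq_sInf]
  exact Nat.sInf_le h

/-- The witness `N` rules out the default value `sInf ∅ = 0`; coverability passes down to smaller
vertex sets. -/
theorem lt_bergeRamsey {r n N k : ℕ} (hN : ¬ TriCover (completeUniform r N) k)
    (h : TriCover (completeUniform r n) k) : n < bergeRamsey r triangleGraph k := by
  rw [bergeRamsey_eq_sInf]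
  by_contra hlt
  exact Nat.sInf_mem (s := {n | ¬ TriCover (completeUniform r n) k}) ⟨N, hN⟩
    (h.completeUniform_mono (not_lt.1 hlt))

theorem bergeDual_le {n m : ℕ} (h : TriCover (allSubsets n) m) :
    bergeDual n triangleGraph ≤ m := by
  rw [bergeDual_eq_sInf]
  exact Nat.sInf_le h

theorem triCover_bergeDual {n m : ℕ} (h : TriCover (allSubsets n) m) :
    TriCover (allSubsets n) (bergeDual n triangleGraph) := by
  rw [bergeDual_eq_sInf]
  exact Nat.sInf_mem (s := {m | TriCover (allSubsets n) m}) ⟨m, h⟩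

/-! ### Győri's bound for triangle-free triple systems -/

/-- In a Berge-triangle-free family at most one pair of a triple is in another hyperedge. -/
theorem TriFree.not_two_shared_pairs {V : Type*} {S : Set (Finset V)}
    (hS : TriFree S) (h3 : ∀ e ∈ S, e.card = 3) {e e₁ e₂ : Finset V} (he : e ∈ S)
    (he₁ : e₁ ∈ S) (he₂ : e₂ ∈ S) (h₁ : e₁ ≠ e) (h₂ : e₂ ≠ e) {a b c : V} (hab : a ≠ b)
    (hac : a ≠ c) (hbc : b ≠ c) (ha : a ∈ e) (hb : b ∈ e) (hc : c ∈ e) (ha₁ : a ∈ e₁)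
    (hb₁ : b ∈ e₁) (ha₂ : a ∈ e₂) (hc₂ : c ∈ e₂) : False := by
  classical
  refine hS e₁ he₁ e he e₂ he₂ ⟨h₁, h₂.symm, ?_, b, c, a, hbc, hac.symm, hab.symm,
    ⟨hb₁, hb⟩, ⟨hc, hc₂⟩, ⟨ha₁, ha₂⟩⟩
  -- If `e₁ = e₂`, this triple contains `a, b, c` and hence equals `e`.
  rintro rfl
  have habc : ({a, b, c} : Finset V).card = 3 := Finset.card_eq_three.2 ⟨a, b, c, hab, hac, hbc, rfl⟩
  have h4 : ({a, b, c} : Finset V) = e := Finset.eq_of_subset_of_card_le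
    (by simp only [Finset.insert_subset_iff, Finset.singleton_subset_iff]; tauto) (by rw [h3 e he, habc])
  have h5 : ({a, b, c} : Finset V) = e₁ := Finset.eq_of_subset_of_card_le
    (by simp only [Finset.insert_subset_iff, Finset.singleton_subset_iff]; tauto) (by rw [h3 e₁ he₁, habc])
  exact h₁ (h5.symm.trans h4)

/-- Each triple of a Berge-triangle-free family has a vertex both of whose pairs lie in no other
triple. -/
theorem TriFree.exists_own_vertex {V : Type*} {S : Set (Finset V)} (hS : TriFree S)
    (h3 : ∀ e ∈ S, e.card = 3) {e : Finset V} (he : e ∈ S) :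
    ∃ v ∈ e, ∀ u ∈ e, u ≠ v → ∀ e' ∈ S, v ∈ e' → u ∈ e' → e' = e := by
  classical
  -- Otherwise every vertex of `e` is on a shared pair. The shared pair at one vertex misses some
  -- other vertex, whose own shared pair is a second one.
  by_contra! hcon
  obtain ⟨a, b, c, hab, hac, hbc, rfl⟩ := Finset.card_eq_three.1 (h3 e he)
  obtain ⟨u, hu, hua, e₁, he₁, ha₁, hu₁, h₁⟩ := hcon a (by simp)
  obtain ⟨v, hv, hvb, e₂, he₂, hb₂, hv₂, h₂⟩ := hcon b (by simp)
  obtain ⟨w, hw, hwc, e₃, he₃, hc₃, hw₃, h₃⟩ := hcon c (by simp)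
  simp only [Finset.mem_insert, Finset.mem_singleton] at hu hv hw
  rcases hu with rfl | rfl | rfl
  · exact hua rfl
  · rcases hw with rfl | rfl | rfl
    · exact hS.not_two_shared_pairs h3 he he₁ he₃ h₁ h₃ hab hac hbc (by simp) (by simp) (by simp) ha₁ hu₁ hw₃ hc₃
    · exact hS.not_two_shared_pairs h3 he he₁ he₃ h₁ h₃ hab.symm hbc hac (by simp) (by simp) (by simp) hu₁ ha₁
        hw₃ hc₃
    · exact hwc rfl
  · rcases hv with rfl | rfl | rfl
    · exact hS.not_two_shared_pairs h3 he he₁ he₂ h₁ h₂ hac hab hbc.symm (by simp) (by simp) (by simp) ha₁ hu₁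
        hv₂ hb₂
    · exact hvb rfl
    · exact hS.not_two_shared_pairs h3 he he₁ he₂ h₁ h₂ hac.symm hbc.symm hab (by simp) (by simp) (by simp) hu₁
        ha₁ hv₂ hb₂

/-- Győri's bound for `3`-uniform hypergraphs without Berge triangles. -/
theorem TriFree.eight_mul_card_le {V : Type*} [Fintype V] {H : Finset (Finset V)}
    (hH : TriFree (H : Set (Finset V))) (h3 : ∀ e ∈ H, e.card = 3) :
    8 * H.card ≤ Fintype.card V ^ 2 := by
  classical
  obtain hV | hV := isEmpty_or_nonempty V
  · have : H = ∅ := Finset.eq_empty_of_forall_notMem fun e he => by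
      have := h3 e he
      rw [Finset.eq_empty_of_isEmpty e] at this
      simp at this
    simp [this]
  choose! v hvm hv using fun e (he : e ∈ H) => hH.exists_own_vertex h3 he
  let G : SimpleGraph V :=
    { Adj := fun x y => x ≠ y ∧ ∃ e ∈ H, x ∈ e ∧ y ∈ e ∧ (v e = x ∨ v e = y)
      symm := ⟨fun x y ⟨hxy, e, he, hx, hy, h⟩ => ⟨hxy.symm, e, he, hy, hx, h.symm⟩⟩
      loopless := ⟨fun x h => h.1 rfl⟩ }
  have own : ∀ e ∈ H, ∀ e' ∈ H, ∀ x y, x ≠ y → x ∈ e → y ∈ e → (v e = x ∨ v e = y) →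
      x ∈ e' → y ∈ e' → e' = e := by
    rintro e he e' he' x y hxy hx hy (h | h) hx' hy'
    · subst h
      exact hv e he y hy hxy.symm e' he' hx' hy'
    · subst h
      exact hv e he x hx hxy e' he' hy' hx'
  have hfree : G.CliqueFree 3 := by
    intro s hs
    obtain ⟨x, y, z, hxy, hxz, hyz, rfl⟩ := SimpleGraph.is3Clique_iff.1 hs
    obtain ⟨nxy, e₁, he₁, hx₁, hy₁, hv₁⟩ := hxy
    obtain ⟨nxz, e₂, he₂, hx₂, hz₂, hv₂⟩ := hxz
    obtain ⟨nyz, e₃, he₃, hy₃, hz₃, hv₃⟩ := hyz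
    -- No vertex lies on all three sides of a triangle, so the distinguished vertex of one triple
    -- cannot account for all three edges.
    have same : e₁ = e₂ → e₂ = e₃ → False := by
      rintro rfl rfl
      rcases hv₁ with h | h <;> rcases hv₂ with h' | h' <;> rcases hv₃ with h'' | h'' <;>
        simp_all
    by_cases h12 : e₁ = e₂
    · subst h12
      exact same rfl (own e₃ he₃ e₁ he₁ y z nyz hy₃ hz₃ hv₃ hy₁ hz₂)
    by_cases h23 : e₂ = e₃
    · subst h23
      exact h12 (own e₁ he₁ e₂ he₂ x y nxy hx₁ hy₁ hv₁ hx₂ hy₃).symm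
    by_cases h13 : e₁ = e₃
    · subst h13
      exact h12 (own e₂ he₂ e₁ he₁ x z nxz hx₂ hz₂ hv₂ hx₁ hz₃)
    exact hH e₁ he₁ e₃ he₃ e₂ he₂ ⟨h13, Ne.symm h23, h12, y, z, x, nyz, nxz.symm, nxy.symm,
      ⟨hy₁, hy₃⟩, ⟨hz₃, hz₂⟩, ⟨hx₁, hx₂⟩⟩
  -- Mantel's theorem, as Turán's bound with `r = 2`; the remainder modulo `2` contributes no edges.
  have hmantel : G.edgeFinset.card ≤ Fintype.card V ^ 2 / 4 := by
    have h := SimpleGraph.CliqueFree.card_edgeFinset_le (r := 2) hfree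
    have h2 : (Fintype.card V % 2).choose 2 = 0 := Nat.choose_eq_zero_of_lt (Nat.mod_lt _ (by simp))
    simp only [h2] at h
    refine h.trans ?_
    simp only [add_zero, Nat.add_one_sub_one, mul_one]
    exact Nat.div_le_div_right (Nat.sub_le _ _)
  have hcard : 2 * H.card ≤ G.edgeFinset.card := by
    have hs : (H.sigma fun e => e.erase (v e)).card = 2 * H.card := by
      rw [Finset.card_sigma, Finset.sum_congr rfl (fun e he => by
        rw [Finset.card_erase_of_mem (hvm e he), h3 e he] : ∀ e ∈ H, (e.erase (v e)).card = 2)]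
      simp [mul_comm]
    rw [← hs]
    refine Finset.card_le_card_of_injOn (fun p => s(v p.1, p.2)) ?_ ?_
    · rintro ⟨e, u⟩ h
      simp only [Finset.coe_sigma, Set.mem_sigma_iff, Finset.mem_coe, Finset.mem_erase] at h
      simp only [SimpleGraph.coe_edgeFinset, SimpleGraph.mem_edgeSet]
      exact ⟨h.2.1.symm, e, h.1, hvm e h.1, h.2.2, Or.inl rfl⟩
    · rintro ⟨e, u⟩ h ⟨e', u'⟩ h' heq
      simp only [Finset.coe_sigma, Set.mem_sigma_iff, Finset.mem_coe, Finset.mem_erase] at h h'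
      obtain ⟨he, hu, hue⟩ := h
      obtain ⟨he', hu', hue'⟩ := h'
      have hmem : v e ∈ e' ∧ u ∈ e' := by
        rcases Sym2.eq_iff.1 heq with ⟨h1, h2⟩ | ⟨h1, h2⟩
        · exact ⟨by rw [h1]; exact hvm e' he', by rw [show u = u' from h2]; exact hue'⟩
        · exact ⟨by rw [h1]; exact hue', by rw [show u = v e' from h2]; exact hvm e' he'⟩
      obtain rfl := own e he e' he' (v e) u hu.symm (hvm e he) hue (Or.inl rfl) hmem.1 hmem.2
      rcases Sym2.eq_iff.1 heq with ⟨-, h2⟩ | ⟨h1, h2⟩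
      · simp only at h2
        rw [h2]
      · exact absurd h2 hu
  omega

/-- A cover of all triples of an `n`-set needs at least `C(n, 3) / ⌊n² / 8⌋` families. -/
theorem TriCover.choose_le {n k : ℕ} (h : TriCover (completeUniform 3 n) k) :
    n.choose 3 ≤ k * (n ^ 2 / 8) := by
  classical
  obtain ⟨P, hP, hE⟩ := h
  have hsub : Finset.powersetCard 3 (Finset.univ : Finset (Fin n)) ⊆ Finset.univ.biUnion
      fun i => {e ∈ Finset.powersetCard 3 (Finset.univ : Finset (Fin n)) | e ∈ P i} := by
    intro e he
    obtain ⟨i, hi⟩ := hE e (Finset.mem_powersetCard.1 he).2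
    exact Finset.mem_biUnion.2 ⟨i, Finset.mem_univ _, Finset.mem_filter.2 ⟨he, hi⟩⟩
  have h1 := Finset.card_le_card hsub
  rw [Finset.card_powersetCard, Finset.card_univ, Fintype.card_fin] at h1
  refine h1.trans ((Finset.card_biUnion_le_card_mul _ _ (n ^ 2 / 8) fun i _ => ?_).trans
    (by simp))
  have h2 := TriFree.eight_mul_card_le
    (H := {e ∈ Finset.powersetCard 3 (Finset.univ : Finset (Fin n)) | e ∈ P i})
    ((hP i).mono fun e he => (Finset.mem_filter.1 he).2)
    (fun e he => (Finset.mem_powersetCard.1 (Finset.mem_filter.1 he).1).2)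
  rw [Fintype.card_fin] at h2
  omega

/-! ### Covering all triples by recursive halving -/

/-- Triples with two vertices in `a` and one outside `a` form a Berge-triangle-free family when
any two of them have equal or disjoint intersections with `a`. -/
theorem triFree_of_matching {V : Type*} [DecidableEq V] {S : Set (Finset V)} {a : Finset V}
    (h2 : ∀ e ∈ S, (e ∩ a).card = 2) (h1 : ∀ e ∈ S, (e \ a).card = 1)
    (hm : ∀ e ∈ S, ∀ e' ∈ S, ∀ x ∈ a, x ∈ e → x ∈ e' → e ∩ a = e' ∩ a) : TriFree S := by
  have hout : ∀ e ∈ S, ∀ x ∉ a, ∀ y ∉ a, x ∈ e → y ∈ e → x = y := by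
    intro e he x hx y hy hxe hye
    exact Finset.card_le_one.1 (h1 e he).le x (by simp [*]) y (by simp [*])
  have heq : ∀ e ∈ S, ∀ e' ∈ S, e ∩ a = e' ∩ a → ∀ x ∉ a, x ∈ e → x ∈ e' → e = e' := by
    intro e he e' he' h x hx hxe hxe'
    ext y
    by_cases hy : y ∈ a
    · have := Finset.ext_iff.1 h y
      simpa [hy] using this
    · constructor
      · intro hye
        exact hout e he x hx y hy hxe hye ▸ hxe'
      · intro hye
        exact hout e' he' x hx y hy hxe' hye ▸ hxe
  have hin : ∀ e ∈ S, ∀ x ∈ a, ∀ y ∈ a, ∀ z ∈ a, x ∈ e → y ∈ e → z ∈ e → x ≠ y → y ≠ z →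
      x = z := by
    intro e he x hx y hy z hz hxe hye hze hxy hyz
    by_contra hxz
    have : 2 < (e ∩ a).card :=
      Finset.two_lt_card.2 ⟨x, by simp [*], y, by simp [*], z, by simp [*], hxy, hxz, hyz⟩
    have := h2 e he
    omega
  rintro A hA B hB C hC ⟨hAB, hBC, hAC, x, y, z, hxy, hyz, hxz, ⟨hxA, hxB⟩, ⟨hyB, hyC⟩, hzA, hzC⟩
  -- Count the representatives inside `a`. Three overfill a two-point trace. With exactly two, all
  -- traces agree, and the outer representative makes two triples equal. With at most one, some
  -- triple has two outer points.
  by_cases hx : x ∈ a <;> by_cases hy : y ∈ a <;> by_cases hz : z ∈ a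
  · have hy' : y ∈ A := by
      have : y ∈ A ∩ a := hm B hB A hA x hx hxB hxA ▸ Finset.mem_inter.2 ⟨hyB, hy⟩
      exact (Finset.mem_inter.1 this).1
    exact hxz (hin A hA x hx y hy z hz hxA hy' hzA hxy hyz)
  · exact hAC (heq A hA C hC ((hm A hA B hB x hx hxA hxB).trans (hm B hB C hC y hy hyB hyC))
      z hz hzA hzC)
  · exact hBC (heq B hB C hC ((hm B hB A hA x hx hxB hxA).trans (hm A hA C hC z hz hzA hzC))
      y hy hyB hyC)
  · exact hyz (hout C hC y hy z hz hyC hzC)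
  · exact hAB (heq A hA B hB ((hm A hA C hC z hz hzA hzC).trans (hm C hC B hB y hy hyC hyB))
      x hx hxA hxB)
  · exact hxz (hout A hA x hx z hz hxA hzA)
  · exact hxy (hout B hB x hx y hy hxB hyB)
  · exact hxy (hout B hB x hx y hy hxB hyB)

/-- Label `a` injectively by residues modulo `m` and color a pair by its sum. One endpoint and the
sum determine the other endpoint, so each color class of pairs is a matching. -/
theorem triCover_two_one {V : Type*} [DecidableEq V] (a : Finset V) {m : ℕ} (ha : a.card ≤ m) :
    TriCover {e | (e ∩ a).card = 2 ∧ (e \ a).card = 1} m := by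
  obtain ⟨φ⟩ : Nonempty (a ↪ Fin m) := Function.Embedding.nonempty_of_card_le (by simpa using ha)
  let f : V → ℕ := fun x => if h : x ∈ a then φ ⟨x, h⟩ else 0
  have hlt : ∀ x ∈ a, f x < m := fun x hx => by simp [f, hx]
  have hinj : ∀ x ∈ a, ∀ y ∈ a, f x = f y → x = y := by
    intro x hx y hy h
    simp only [f, hx, hy, dif_pos] at h
    exact congrArg Subtype.val (φ.injective (Fin.ext h))
  refine ⟨fun i => {e | ((e ∩ a).card = 2 ∧ (e \ a).card = 1) ∧
    (∑ x ∈ e ∩ a, f x) % m = i}, fun i => ?_, ?_⟩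
  · refine triFree_of_matching (a := a) (fun e he => he.1.1) (fun e he => he.1.2) ?_
    intro e he e' he' x hx hxe hxe'
    have hpair : ∀ d : Finset V, (d ∩ a).card = 2 → x ∈ d → ∃ y ∈ a, x ≠ y ∧ d ∩ a = {x, y} := by
      intro d hd hxd
      obtain ⟨y, hy⟩ := Finset.card_eq_one.1
        (show ((d ∩ a).erase x).card = 1 by
          rw [Finset.card_erase_of_mem (Finset.mem_inter.2 ⟨hxd, hx⟩), hd])
      have hy' : y ∈ (d ∩ a).erase x := by simp [hy]
      refine ⟨y, (Finset.mem_inter.1 (Finset.mem_of_mem_erase hy')).2,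
        (Finset.ne_of_mem_erase hy').symm, ?_⟩
      rw [← Finset.insert_erase (Finset.mem_inter.2 ⟨hxd, hx⟩), hy]
    obtain ⟨y, hya, hxy, hy⟩ := hpair e he.1.1 hxe
    obtain ⟨z, hza, hxz, hz⟩ := hpair e' he'.1.1 hxe'
    have h := he.2.trans he'.2.symm
    rw [hy, hz, Finset.sum_pair hxy, Finset.sum_pair hxz] at h
    have h' : f y ≡ f z [MOD m] := Nat.ModEq.add_left_cancel' (f x) h
    rw [hy, hz, hinj y hya z hza (Nat.ModEq.eq_of_lt_of_lt h' (hlt y hya) (hlt z hza))]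
  · intro e he
    have hm : 0 < m := by
      obtain ⟨x, hx⟩ := Finset.card_pos.1 (show 0 < (e ∩ a).card by rw [he.1]; simp)
      exact (Nat.zero_le _).trans_lt (hlt x (Finset.mem_inter.1 hx).2)
    exact ⟨⟨_, Nat.mod_lt _ hm⟩, he, rfl⟩

/-- Hyperedges on opposite sides never meet, so a Berge triangle stays on one side and the same
colors serve both. -/
theorem TriCover.union_of_disjoint {V : Type*} {E F : Set (Finset V)} {k : ℕ} {a b : Finset V}
    (hab : Disjoint a b) (hE : TriCover E k) (hF : TriCover F k) (ha : ∀ e ∈ E, e ⊆ a)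
    (hb : ∀ e ∈ F, e ⊆ b) : TriCover (E ∪ F) k := by
  obtain ⟨P, hP, hE⟩ := hE
  obtain ⟨Q, hQ, hF⟩ := hF
  refine ⟨fun i => {e | e ∈ P i ∧ e ⊆ a} ∪ {e | e ∈ Q i ∧ e ⊆ b}, fun i => ?_, ?_⟩
  · rintro A hA B hB C hC hT
    have hT' := hT
    obtain ⟨hAB, hBC, hAC, x, y, z, hxy, hyz, hxz, ⟨hxA, hxB⟩, ⟨hyB, hyC⟩, hzA, hzC⟩ := hT'
    have hdis := fun x (hx : x ∈ a) (hx' : x ∈ b) => Finset.disjoint_left.1 hab hx hx'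
    rcases hA with hA | hA <;> rcases hB with hB | hB
    · rcases hC with hC | hC
      · exact hP i A hA.1 B hB.1 C hC.1 hT
      · exact hdis y (hB.2 hyB) (hC.2 hyC)
    · exact hdis x (hA.2 hxA) (hB.2 hxB)
    · exact hdis x (hB.2 hxB) (hA.2 hxA)
    · rcases hC with hC | hC
      · exact hdis y (hC.2 hyC) (hB.2 hyB)
      · exact hQ i A hA.1 B hB.1 C hC.1 hT
  · rintro e (he | he)
    · obtain ⟨i, hi⟩ := hE e he
      exact ⟨i, Or.inl ⟨hi, ha e he⟩⟩
    · obtain ⟨i, hi⟩ := hF e he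
      exact ⟨i, Or.inr ⟨hi, hb e he⟩⟩

/-- Split `s` into halves of size at most `m = ⌈n/2⌉`. Triples crossing the split cost `m` colors
for each half, and the triples inside the halves are handled recursively with shared colors.
Rounding up costs a bounded amount per level, which the logarithmic term absorbs. -/
theorem triCover_triples {V : Type*} [DecidableEq V] (n : ℕ) :
    ∀ s : Finset V, s.card ≤ n → TriCover {e | e ⊆ s ∧ e.card = 3} (2 * n + 3 * Nat.clog 2 n) := by
  induction n using Nat.strong_induction_on with
  | _ n ih =>
  intro s hs
  by_cases hn : n < 2
  · refine (TriCover.empty _).subset fun e he => ?_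
    have := Finset.card_le_card he.1
    have := he.2
    omega
  obtain ⟨a, has, ha⟩ := Finset.exists_subset_card_eq (s := s) (n := s.card / 2) (by omega)
  have hb : (s \ a).card = s.card - s.card / 2 := by rw [Finset.card_sdiff_of_subset has, ha]
  set m := (n + 1) / 2 with hm
  have hclog : Nat.clog 2 n = Nat.clog 2 m + 1 := by
    rw [Nat.clog_of_two_le (by omega) (by omega)]
    congr 2
  have hrec := TriCover.union_of_disjoint (Finset.disjoint_sdiff (s := a) (t := s))
    (ih m (by omega) a (by omega)) (ih m (by omega) (s \ a) (by omega))
    (fun e he => he.1) (fun e he => he.1)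
  have hcross := (triCover_two_one a (m := m) (by omega)).union
    (triCover_two_one (s \ a) (m := m) (by omega))
  refine ((hcross.union hrec).mono ?_).subset ?_
  · omega
  · rintro e ⟨hes, he⟩
    have h1 : e ∩ (s \ a) = e \ a := by
      ext x
      have := @hes x
      simp only [Finset.mem_inter, Finset.mem_sdiff]
      tauto
    have h2 : e \ (s \ a) = e ∩ a := by
      ext x
      have := @hes x
      simp only [Finset.mem_inter, Finset.mem_sdiff]
      tauto
    have h3 := Finset.card_inter_add_card_sdiff e a
    have h4 : (e ∩ a).card ≤ 3 := by omega
    simp only [Set.mem_union, Set.mem_ofPred_eq, h1, h2]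
    have h5 : (e \ a).card = 0 → e ⊆ a := fun h => by
      rwa [Finset.card_eq_zero, Finset.sdiff_eq_empty_iff_subset] at h
    have h6 : (e ∩ a).card = 0 → e ⊆ s \ a := fun h => by
      rw [Finset.card_eq_zero, ← Finset.disjoint_iff_inter_eq_empty] at h
      exact Finset.subset_sdiff.2 ⟨hes, h⟩
    by_cases c0 : (e ∩ a).card = 0
    · exact Or.inr (Or.inr ⟨h6 c0, he⟩)
    by_cases c3 : (e \ a).card = 0
    · exact Or.inr (Or.inl ⟨h5 c3, he⟩)
    left
    omega

/-! ### Explicit covers for small vertex sets -/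

/-- All quantifiers in `hP` are bounded by finite sets, with representatives ranging only over
pairwise intersections, so the kernel can evaluate the condition. -/
theorem triCover_of_classes {n k : ℕ} {E : Set (Finset (Fin n))}
    (P : Fin k → Finset (Finset (Fin n)))
    (hP : ∀ i, ∀ A ∈ P i, ∀ B ∈ P i, ∀ C ∈ P i, A ≠ B → B ≠ C → A ≠ C →
      ∀ x ∈ A ∩ B, ∀ y ∈ B ∩ C, x ≠ y → ∀ z ∈ A ∩ C, ¬ (y ≠ z ∧ x ≠ z))
    (hE : ∀ e ∈ E, ∃ i, e ∈ P i) : TriCover E k := by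
  refine ⟨fun i => P i, fun i A hA B hB C hC hT => ?_, hE⟩
  obtain ⟨hAB, hBC, hAC, x, y, z, hxy, hyz, hxz, hx, hy, hz⟩ := hT
  exact hP i A hA B hB C hC hAB hBC hAC x (Finset.mem_inter.2 hx) y (Finset.mem_inter.2 hy) hxy z
    (Finset.mem_inter.2 hz) ⟨hyz, hxz⟩

theorem triCover_four_two : TriCover (completeUniform 3 4) 2 := by
  refine triCover_of_classes ![{{0, 1, 2}, {0, 1, 3}}, {{0, 2, 3}, {1, 2, 3}}]
    (by decide +kernel) fun e he => ?_
  revert e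
  unfold completeUniform
  simp only [Set.mem_ofPred_eq]
  decide +kernel

theorem triCover_five_four : TriCover (completeUniform 3 5) 4 := by
  refine triCover_of_classes ![{{0, 1, 2}, {0, 2, 3}},
    {{1, 2, 4}, {2, 3, 4}},
    {{0, 1, 3}, {1, 2, 3}, {1, 3, 4}},
    {{0, 1, 4}, {0, 2, 4}, {0, 3, 4}}]
    (by decide +kernel) fun e he => ?_
  revert e
  unfold completeUniform
  simp only [Set.mem_ofPred_eq]
  decide +kernel

theorem triCover_six_five : TriCover (completeUniform 3 6) 5 := by
  refine triCover_of_classes ![{{1, 2, 3}, {0, 1, 4}, {2, 3, 5}, {0, 4, 5}},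
    {{1, 2, 4}, {1, 3, 4}, {0, 2, 5}, {0, 3, 5}},
    {{0, 2, 4}, {0, 3, 4}, {1, 2, 5}, {1, 3, 5}},
    {{0, 1, 2}, {0, 1, 3}, {2, 4, 5}, {3, 4, 5}},
    {{0, 2, 3}, {2, 3, 4}, {0, 1, 5}, {1, 4, 5}}]
    (by decide +kernel) fun e he => ?_
  revert e
  unfold completeUniform
  simp only [Set.mem_ofPred_eq]
  decide +kernel

theorem triCover_seven_six : TriCover (completeUniform 3 7) 6 := by
  refine triCover_of_classes ![
    {{0, 1, 2}, {0, 2, 3}, {0, 2, 5}, {1, 4, 6}, {3, 4, 6}, {4, 5, 6}},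
    {{0, 3, 4}, {1, 3, 4}, {3, 4, 5}, {0, 2, 6}, {1, 2, 6}, {2, 5, 6}},
    {{0, 1, 5}, {1, 2, 5}, {1, 3, 5}, {1, 4, 5}, {1, 5, 6}},
    {{1, 2, 3}, {2, 3, 4}, {2, 3, 5}, {0, 1, 6}, {0, 4, 6}, {0, 5, 6}},
    {{0, 1, 3}, {1, 2, 4}, {0, 3, 5}, {2, 4, 5}, {0, 3, 6}, {2, 4, 6}},
    {{0, 1, 4}, {0, 2, 4}, {0, 4, 5}, {1, 3, 6}, {2, 3, 6}, {3, 5, 6}}]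
    (by decide +kernel) fun e he => ?_
  revert e
  unfold completeUniform
  simp only [Set.mem_ofPred_eq]
  decide +kernel

/-- Split into two 4-sets. The three perfect matchings of each half give six classes of crossing
triples; the last two classes cover the triples inside both halves at once, as in
`triCover_four_two`. -/
theorem triCover_eight_eight : TriCover (completeUniform 3 8) 8 := by
  refine triCover_of_classes ![
    {{0, 1, 4}, {0, 1, 5}, {0, 1, 6}, {0, 1, 7}, {2, 3, 4}, {2, 3, 5}, {2, 3, 6}, {2, 3, 7}},
    {{0, 2, 4}, {0, 2, 5}, {0, 2, 6}, {0, 2, 7}, {1, 3, 4}, {1, 3, 5}, {1, 3, 6}, {1, 3, 7}},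
    {{0, 3, 4}, {0, 3, 5}, {0, 3, 6}, {0, 3, 7}, {1, 2, 4}, {1, 2, 5}, {1, 2, 6}, {1, 2, 7}},
    {{4, 5, 0}, {4, 5, 1}, {4, 5, 2}, {4, 5, 3}, {6, 7, 0}, {6, 7, 1}, {6, 7, 2}, {6, 7, 3}},
    {{4, 6, 0}, {4, 6, 1}, {4, 6, 2}, {4, 6, 3}, {5, 7, 0}, {5, 7, 1}, {5, 7, 2}, {5, 7, 3}},
    {{4, 7, 0}, {4, 7, 1}, {4, 7, 2}, {4, 7, 3}, {5, 6, 0}, {5, 6, 1}, {5, 6, 2}, {5, 6, 3}},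
    {{0, 1, 2}, {0, 1, 3}, {4, 5, 6}, {4, 5, 7}},
    {{0, 2, 3}, {1, 2, 3}, {4, 6, 7}, {5, 6, 7}}]
    (by decide +kernel) fun e he => ?_
  revert e
  unfold completeUniform
  simp only [Set.mem_ofPred_eq]
  decide +kernel

/-- The first class holds three 3-sets meeting pairwise in `{1, 3}`, which offers only two
representatives. This is how `n = 5` escapes `bergeTri_of_large`. -/
theorem triCover_allSubsets_five : TriCover (allSubsets 5) 7 := by
  refine triCover_of_classes ![
    {∅, {0}, {1}, {2}, {3}, {4}, {1, 3}, {0, 1, 3}, {1, 2, 3}, {1, 3, 4}},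
    {{0, 3}, {2, 4}, {1, 2, 4}, {0, 2, 3, 4}},
    {{0, 1, 3, 4}, {0, 1, 2, 3, 4}},
    {{0, 4}, {0, 1, 4}, {0, 2, 4}, {0, 3, 4}},
    {{0, 2}, {0, 2, 3}, {1, 4}, {0, 1, 2, 4}},
    {{1, 2}, {0, 1, 2}, {3, 4}, {1, 2, 3, 4}},
    {{0, 1}, {2, 3}, {0, 1, 2, 3}, {2, 3, 4}}]
    (by decide +kernel) fun e _ => ?_
  clear * -
  revert e
  decide +kernel

/-! ### Bounds for the Ramsey numbers -/

theorem not_triCover_of_lt {n k : ℕ} (h : k * (n ^ 2 / 8) < n.choose 3) :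
    ¬ TriCover (completeUniform 3 n) k := fun hc => absurd hc.choose_le (not_le.2 h)

theorem bergeRamsey_eq {n k k' : ℕ} (hn : TriCover (completeUniform 3 n) k') (hk : k' ≤ k)
    (h : k * ((n + 1) ^ 2 / 8) < (n + 1).choose 3) : bergeRamsey 3 triangleGraph k = n + 1 :=
  le_antisymm (bergeRamsey_le (not_triCover_of_lt h))
    (lt_bergeRamsey (not_triCover_of_lt h) (hn.mono hk))

/-- The count `C(n, 3) > k n²/8` amounts to `3kn < 4(n-1)(n-2)`, and `(n-1)(n-2) > n(n-3)`. -/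
theorem not_triCover_of_three_mul_lt {n k : ℕ} (h : 3 * k + 12 < 4 * n) :
    ¬ TriCover (completeUniform 3 n) k := by
  intro hc
  have h1 := hc.choose_le
  obtain ⟨m, rfl⟩ : ∃ m, n = m + 3 := ⟨n - 3, by omega⟩
  have h2 : (m + 3).choose 3 * 6 = (m + 3) * (m + 2) * (m + 1) := by
    have e1 := Nat.add_one_mul_choose_eq (m + 2) 2
    have e2 := Nat.add_one_mul_choose_eq (m + 1) 1
    simp only [Nat.choose_one_right, Nat.reduceAdd, add_assoc] at e1 e2
    nlinarith
  have h3 : (m + 3) ^ 2 / 8 * 8 ≤ (m + 3) ^ 2 := Nat.div_mul_le_self _ _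
  have h4 : 8 * ((m + 3) * ((m + 2) * (m + 1))) ≤ (m + 3) * (6 * k * (m + 3)) := by
    have := Nat.mul_le_mul_left (6 * k) h3
    nlinarith
  have h5 : 8 * ((m + 2) * (m + 1)) ≤ 6 * k * (m + 3) :=
    Nat.le_of_mul_le_mul_left (by linarith) (show 0 < m + 3 by omega)
  have h6 : 6 * k * (m + 3) ≤ (8 * m - 2) * (m + 3) := Nat.mul_le_mul_right _ (by omega)
  have h7 : (8 * m - 2) * (m + 3) ≤ 8 * m * (m + 3) := Nat.mul_le_mul_right _ (by omega)
  nlinarith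

theorem bergeRamsey_le_three_quarters (k : ℕ) :
    bergeRamsey 3 triangleGraph k ≤ 3 * k / 4 + 4 :=
  bergeRamsey_le (not_triCover_of_three_mul_lt (by omega))

theorem half_le_bergeRamsey (k : ℕ) :
    k ≤ 2 * bergeRamsey 3 triangleGraph k + 3 * Nat.clog 2 k := by
  -- The largest `n` with `2n + 3 clog k ≤ k`, so that the cover of `triCover_triples` fits into `k`
  -- colors. If the subtraction truncates, the claim is trivial.
  set n := (k - 3 * Nat.clog 2 k) / 2 with hn
  by_cases hk : k < 3 * Nat.clog 2 k
  · omega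
  have h : TriCover (completeUniform 3 n) k := by
    have hc := triCover_triples (V := Fin n) n Finset.univ (by simp)
    have hclog : Nat.clog 2 n ≤ Nat.clog 2 k := Nat.clog_mono_right 2 (by omega)
    exact (hc.mono (by omega)).subset fun e he => ⟨Finset.subset_univ e, he⟩
  have := lt_bergeRamsey (N := 3 * k / 4 + 4) (not_triCover_of_three_mul_lt (by omega)) h
  omega

theorem isLittleO_clog :
    (fun k : ℕ => 3 / 2 * (Nat.clog 2 k : ℝ)) =o[atTop] (fun k : ℕ => (k : ℝ)) := by
  refine IsLittleO.const_mul_left ?_ _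
  have h1 : (fun k : ℕ => Real.log k) =o[atTop] (fun k : ℕ => (k : ℝ)) :=
    Real.isLittleO_log_id_atTop.comp_tendsto tendsto_natCast_atTop_atTop
  have h2 : (fun _ : ℕ => (1 : ℝ)) =o[atTop] (fun k : ℕ => (k : ℝ)) :=
    (isLittleO_const_id_atTop (1 : ℝ)).comp_tendsto tendsto_natCast_atTop_atTop
  refine IsBigO.trans_isLittleO ?_ ((h1.const_mul_left (Real.log 2)⁻¹).add h2)
  refine IsBigO.of_bound 1 ?_
  filter_upwards [eventually_ge_atTop 1] with k hk
  have hc : (Nat.clog 2 k : ℝ) ≤ (Real.log 2)⁻¹ * Real.log k + 1 := by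
    have h3 : Nat.clog 2 k ≤ Nat.log 2 k + 1 := by
      refine Nat.clog_le_of_le_pow ?_
      exact (Nat.lt_pow_succ_log_self (by norm_num) k).le
    have h4 : (Nat.log 2 k : ℝ) ≤ Real.logb 2 k := by
      exact_mod_cast Real.natLog_le_logb k 2
    have h5 : (Nat.clog 2 k : ℝ) ≤ Nat.log 2 k + 1 := by exact_mod_cast h3
    rw [Real.logb, div_eq_inv_mul] at h4
    linarith
  rw [one_mul, Real.norm_of_nonneg (Nat.cast_nonneg _)]
  exact hc.trans (le_abs_self _)

/-! ### Large sets and the lower bound for the dual function -/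

/-- Hall's theorem: `x, y, z` form a system of distinct representatives of the three pairwise
intersections. -/
theorem bergeTri_of_hall {V : Type*} [DecidableEq V] {A B C : Finset V} (hAB : A ≠ B)
    (hBC : B ≠ C) (hAC : A ≠ C) (h1 : 1 ≤ (A ∩ B).card) (h2 : 1 ≤ (B ∩ C).card)
    (h3 : 1 ≤ (A ∩ C).card) (h12 : 2 ≤ (A ∩ B ∪ B ∩ C).card) (h13 : 2 ≤ (A ∩ B ∪ A ∩ C).card)
    (h23 : 2 ≤ (B ∩ C ∪ A ∩ C).card) (h123 : 3 ≤ (A ∩ B ∪ (B ∩ C ∪ A ∩ C)).card) :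
    BergeTri A B C := by
  obtain ⟨f, hf, hmem⟩ := (Finset.all_card_le_biUnion_card_iff_exists_injective
    (![A ∩ B, B ∩ C, A ∩ C] : Fin 3 → Finset V)).1 (by
      intro s
      have hs : s ∈ (Finset.univ : Finset (Finset (Fin 3))) := Finset.mem_univ s
      rw [show (Finset.univ : Finset (Finset (Fin 3))) =
        {∅, {0}, {1}, {2}, {0, 1}, {0, 2}, {1, 2}, {0, 1, 2}} by decide] at hs
      simp only [Finset.mem_insert, Finset.mem_singleton] at hs
      rcases hs with rfl | rfl | rfl | rfl | rfl | rfl | rfl | rfl <;>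
        simp [Finset.biUnion_insert] <;> first | exact h12 | exact h13 | exact h23 | exact h123 | skip
      all_goals first | exact Finset.card_pos.1 h1 | exact Finset.card_pos.1 h2 |
        exact Finset.card_pos.1 h3)
  have m0 := hmem 0
  have m1 := hmem 1
  have m2 := hmem 2
  simp at m0 m1 m2
  exact ⟨hAB, hBC, hAC, f 0, f 1, f 2, hf.ne (by decide), hf.ne (by decide), hf.ne (by decide),
    m0, m1, m2⟩

theorem bergeTri_of_large {n : ℕ} (hn : 6 ≤ n) {A B C : Finset (Fin n)} (hAB : A ≠ B)
    (hBC : B ≠ C) (hAC : A ≠ C) (hA : n < 2 * A.card) (hB : n < 2 * B.card)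
    (hC : n < 2 * C.card) : BergeTri A B C := by
  have hle : ∀ s : Finset (Fin n), s.card ≤ n := fun s => by simpa using Finset.card_le_univ s
  have one : ∀ A B : Finset (Fin n), n < 2 * A.card → n < 2 * B.card → 1 ≤ (A ∩ B).card := by
    intro A B hA hB
    have := Finset.card_union_add_card_inter A B
    have := hle (A ∪ B)
    omega
  have two : ∀ A B C : Finset (Fin n), n < 2 * A.card → n < 2 * B.card → n < 2 * C.card →
      B ≠ C → 2 ≤ (A ∩ B ∪ A ∩ C).card := by
    intro A B C hA hB hC hBC
    rw [← Finset.inter_union_distrib_left]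
    have h1 := Finset.card_union_add_card_inter A (B ∪ C)
    have h2 := hle (A ∪ (B ∪ C))
    -- Two distinct majority sets have a union strictly larger than the smaller of them, which gains
    -- the extra point.
    have h3 : n + 2 < 2 * (B ∪ C).card := by
      by_contra hlt
      have hB' : B = B ∪ C := Finset.eq_of_subset_of_card_le Finset.subset_union_left (by omega)
      have hC' : C = B ∪ C := Finset.eq_of_subset_of_card_le Finset.subset_union_right (by omega)
      exact hBC (hB'.trans hC'.symm)
    omega
  refine bergeTri_of_hall hAB hBC hAC (one A B hA hB) (one B C hB hC) (one A C hA hC) ?_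
    (two A B C hA hB hC hBC) ?_ ?_
  · rw [Finset.inter_comm A B]
    exact two B A C hB hA hC hAC
  · rw [Finset.inter_comm B C, Finset.inter_comm A C]
    exact two C B A hC hB hA hAB.symm
  -- If `t` points lie in at least two of the sets, the sizes sum to at most `n + 2t`. Three
  -- majorities force `t ≥ 3` once `n ≥ 6`; for `n = 5` only `t ≥ 2` follows.
  · have h1 := Finset.card_union_add_card_inter A B
    have h2 := Finset.card_union_add_card_inter (A ∪ B) C
    have h3 := hle (A ∪ B ∪ C)
    have h4 : (A ∩ B).card ≤ (A ∩ B ∪ (B ∩ C ∪ A ∩ C)).card :=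
      Finset.card_le_card Finset.subset_union_left
    have h5 : ((A ∪ B) ∩ C).card ≤ (A ∩ B ∪ (B ∩ C ∪ A ∩ C)).card :=
      Finset.card_le_card fun x => by simp only [Finset.mem_union, Finset.mem_inter]; tauto
    omega

theorem TriCover.card_large_le {n k : ℕ} (hn : 6 ≤ n) (h : TriCover (allSubsets n) k) :
    (Finset.univ.filter fun A : Finset (Fin n) => n < 2 * A.card).card ≤ 2 * k := by
  classical
  obtain ⟨P, hP, hE⟩ := h
  choose c hc using fun A : Finset (Fin n) => hE A (Set.mem_univ A)
  have := Finset.card_le_mul_card_image_of_maps_to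
    (s := Finset.univ.filter fun A : Finset (Fin n) => n < 2 * A.card) (f := c)
    (t := Finset.univ) (fun _ _ => Finset.mem_univ _) 2 (by
      intro i _
      by_contra! hlt
      obtain ⟨A, hA, B, hB, C, hC, hAB, hAC, hBC⟩ := Finset.two_lt_card.1 hlt
      simp only [Finset.mem_filter, Finset.mem_univ, true_and] at hA hB hC
      exact hP i A (hA.2 ▸ hc A) B (hB.2 ▸ hc B) C (hC.2 ▸ hc C)
        (bergeTri_of_large hn hAB hBC hAC hA.1 hB.1 hC.1))
  simpa using this

/-- Complementation matches the sets above the middle layer with those below it. -/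
theorem two_mul_card_large_add (n : ℕ) :
    2 * (Finset.univ.filter fun A : Finset (Fin n) => n < 2 * A.card).card +
      (Finset.univ.filter fun A : Finset (Fin n) => 2 * A.card = n).card = 2 ^ n := by
  have hcompl : (Finset.univ.filter fun A : Finset (Fin n) => 2 * A.card < n).card =
      (Finset.univ.filter fun A : Finset (Fin n) => n < 2 * A.card).card := by
    refine Finset.card_bij' (fun A _ => Aᶜ) (fun A _ => Aᶜ) ?_ ?_ (by simp) (by simp) <;>
    · intro A hA
      have := Finset.card_add_card_compl A
      simp only [Finset.mem_filter, Finset.mem_univ, true_and, Fintype.card_fin] at *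
      omega
  have h1 := Finset.card_filter_add_card_filter_not (s := (Finset.univ : Finset (Finset (Fin n))))
    (fun A => n < 2 * A.card)
  have h2 := Finset.card_filter_add_card_filter_not
    (s := Finset.univ.filter fun A : Finset (Fin n) => ¬ n < 2 * A.card) (fun A => 2 * A.card = n)
  rw [Finset.filter_filter, Finset.filter_filter] at h2
  rw [Finset.filter_congr (q := fun A : Finset (Fin n) => 2 * A.card = n)
      (fun A _ => by omega),
    Finset.filter_congr (p := fun A : Finset (Fin n) => ¬ n < 2 * A.card ∧ ¬ 2 * A.card = n)
      (q := fun A : Finset (Fin n) => 2 * A.card < n) (fun A _ => by omega), hcompl] at h2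
  simp only [Finset.card_univ, Fintype.card_finset, Fintype.card_fin] at h1
  omega

/-- The induction step is `(2j+1)(2j+3) ≤ 4(j+1)²`. It makes the middle layer a fraction at most
`1/√(n+1)` of all subsets. -/
theorem centralBinom_sq_mul_le (j : ℕ) : j.centralBinom ^ 2 * (2 * j + 1) ≤ 16 ^ j := by
  induction j with
  | zero => simp
  | succ j ih =>
    have h := Nat.succ_mul_centralBinom_succ j
    refine Nat.le_of_mul_le_mul_left ?_ (show 0 < (j + 1) ^ 2 by positivity)
    calc (j + 1) ^ 2 * ((j + 1).centralBinom ^ 2 * (2 * (j + 1) + 1))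
        = ((j + 1) * (j + 1).centralBinom) ^ 2 * (2 * j + 3) := by ring
      _ = (j.centralBinom ^ 2 * (2 * j + 1)) * (4 * ((2 * j + 1) * (2 * j + 3))) := by
          rw [h]; ring
      _ ≤ 16 ^ j * (4 * (4 * (j + 1) ^ 2)) := by
          refine Nat.mul_le_mul ih ?_
          nlinarith
      _ = (j + 1) ^ 2 * 16 ^ (j + 1) := by ring

theorem card_middle_sq_mul_le (n : ℕ) :
    (Finset.univ.filter fun A : Finset (Fin n) => 2 * A.card = n).card ^ 2 * (n + 1) ≤ 4 ^ n := by
  obtain ⟨j, rfl | rfl⟩ := Nat.even_or_odd' n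
  · have h1 : (Finset.univ.filter fun A : Finset (Fin (2 * j)) => 2 * A.card = 2 * j) =
        Finset.powersetCard j Finset.univ := by
      ext A
      simp [Finset.mem_powersetCard]
    rw [h1, Finset.card_powersetCard, Finset.card_univ, Fintype.card_fin,
      ← Nat.centralBinom_eq_two_mul_choose, pow_mul]
    exact centralBinom_sq_mul_le j
  · have h1 : (Finset.univ.filter fun A : Finset (Fin (2 * j + 1)) => 2 * A.card = 2 * j + 1) =
        ∅ := Finset.filter_eq_empty_iff.2 fun A _ => by omega
    simp [h1]

/-! ### The upper bound for the dual function -/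

/-- A class fixes which points `≥ 2` agree with `0` about membership. The status of `0` and `1` then
determines the set, so the class consists of two complementary pairs. Among any three of its sets
two are complementary, hence disjoint. -/
theorem triCover_allSubsets (m : ℕ) : TriCover (allSubsets (m + 2)) (2 ^ m) := by
  classical
  let ε : Finset (Fin m) ≃ Fin (2 ^ m) := Fintype.equivFinOfCardEq (by simp)
  refine ⟨fun i => {A | ∀ j : Fin m, (j.succ.succ ∈ A ↔ 0 ∈ A) ↔ j ∈ ε.symm i}, fun i => ?_,
    fun A _ => ⟨ε (Finset.univ.filter fun j : Fin m => j.succ.succ ∈ A ↔ 0 ∈ A), by simp⟩⟩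
  -- Whether `0` and `1` agree tells the two complementary pairs apart; distinct sets in the same
  -- pair are disjoint.
  have key : ∀ A ∈ {A : Finset (Fin (m + 2)) |
        ∀ j : Fin m, (j.succ.succ ∈ A ↔ 0 ∈ A) ↔ j ∈ ε.symm i},
      ∀ B ∈ {A : Finset (Fin (m + 2)) | ∀ j : Fin m, (j.succ.succ ∈ A ↔ 0 ∈ A) ↔ j ∈ ε.symm i},
      ((0 ∈ A ↔ 1 ∈ A) ↔ (0 ∈ B ↔ 1 ∈ B)) → A ≠ B → ∀ x ∈ A, x ∉ B := by
    intro A hA B hB h01 hAB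
    by_cases h0 : 0 ∈ A ↔ 0 ∈ B
    · refine absurd ?_ hAB
      ext x
      refine Fin.cases h0 (fun x => Fin.cases ?_ (fun j => ?_) x) x
      · change 1 ∈ A ↔ 1 ∈ B
        clear hA hB
        tauto
      · have hAj := hA j
        have hBj := hB j
        clear hA hB
        tauto
    · intro x
      refine Fin.cases (by clear hA hB; tauto) (fun x => Fin.cases ?_ (fun j => ?_) x) x
      · change 1 ∈ A → 1 ∉ B
        clear hA hB
        tauto
      · have hAj := hA j
        have hBj := hB j
        clear hA hB
        tauto
  rintro A hA B hB C hC ⟨hAB, hBC, hAC, x, y, z, -, -, -, hx, hy, hz⟩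
  by_cases h1 : (0 ∈ A ↔ 1 ∈ A) ↔ (0 ∈ B ↔ 1 ∈ B)
  · exact key A hA B hB h1 hAB x hx.1 hx.2
  by_cases h2 : (0 ∈ A ↔ 1 ∈ A) ↔ (0 ∈ C ↔ 1 ∈ C)
  · exact key A hA C hC h2 hAC z hz.1 hz.2
  · exact key B hB C hC ((not_iff.1 h1).symm.trans (not_iff.1 h2)) hBC y hy.1 hy.2

/-! ### Asymptotics and exact values of the dual function -/

theorem triCover_allSubsets_of_two_le {n : ℕ} (hn : 2 ≤ n) :
    TriCover (allSubsets n) (2 ^ (n - 2)) := by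
  obtain ⟨m, rfl⟩ := Nat.exists_eq_add_of_le' hn
  exact triCover_allSubsets m

theorem two_pow_le_four_mul_bergeDual_add {n : ℕ} (hn : 6 ≤ n) :
    2 ^ n ≤ 4 * bergeDual n triangleGraph +
      (Finset.univ.filter fun A : Finset (Fin n) => 2 * A.card = n).card := by
  have h1 := (triCover_bergeDual (triCover_allSubsets_of_two_le (by omega))).card_large_le hn
  have h2 := two_mul_card_large_add n
  omega

theorem bergeDual_lower_bound (n : ℕ) (hn : 3 ≤ n) :
    (2 : ℝ) ^ (n - 2) * (1 - 3 / √((n : ℝ) + 1)) ≤ (bergeDual n triangleGraph : ℝ) := by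
  have hs : 0 < √((n : ℝ) + 1) := Real.sqrt_pos.2 (by positivity)
  -- The constant `3` makes the left side nonpositive here, since `√(n+1) ≤ 3`; for `n ≥ 6` the
  -- constant `1` would do.
  by_cases h6 : n < 6
  · refine le_trans (mul_nonpos_of_nonneg_of_nonpos (by positivity) ?_) (Nat.cast_nonneg _)
    rw [sub_nonpos, one_le_div hs, Real.sqrt_le_left (by norm_num)]
    have : (n : ℝ) + 1 ≤ 6 := by exact_mod_cast h6
    linarith
  have h1 := two_pow_le_four_mul_bergeDual_add (n := n) (by omega)
  have h2 := card_middle_sq_mul_le n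
  set c := (Finset.univ.filter fun A : Finset (Fin n) => 2 * A.card = n).card
  have h3 : (2 : ℝ) ^ n ≤ 4 * bergeDual n triangleGraph + c := by exact_mod_cast h1
  have h4 : (c : ℝ) * √((n : ℝ) + 1) ≤ 2 ^ n := by
    refine le_of_sq_le_sq ?_ (by positivity)
    rw [mul_pow, Real.sq_sqrt (by positivity), ← pow_mul, mul_comm n 2, pow_mul]
    norm_num
    exact_mod_cast h2
  have h5 : (c : ℝ) ≤ 2 ^ n / √((n : ℝ) + 1) := (le_div_iff₀ hs).2 h4
  have h6 : (2 : ℝ) ^ n = 4 * 2 ^ (n - 2) := by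
    obtain ⟨m, rfl⟩ := Nat.exists_eq_add_of_le' (show 2 ≤ n by omega)
    rw [Nat.add_sub_cancel, pow_add]
    norm_num [mul_comm]
  rw [h6] at h3 h5
  have h7 : (0 : ℝ) ≤ 2 ^ (n - 2) / √((n : ℝ) + 1) := by positivity
  have e1 : (4 : ℝ) * 2 ^ (n - 2) / √((n : ℝ) + 1) = 4 * (2 ^ (n - 2) / √((n : ℝ) + 1)) := by ring
  have e2 : (2 : ℝ) ^ (n - 2) * (1 - 3 / √((n : ℝ) + 1)) =
      2 ^ (n - 2) - 3 * (2 ^ (n - 2) / √((n : ℝ) + 1)) := by ring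
  rw [e2]
  linarith

theorem bergeDual_three : bergeDual 3 triangleGraph = 2 := by
  refine le_antisymm (bergeDual_le (triCover_allSubsets 1)) ?_
  by_contra! hlt
  obtain ⟨P, hP, hE⟩ := (triCover_bergeDual (triCover_allSubsets 1)).mono (Nat.lt_succ_iff.1 hlt)
  have hmem : ∀ A, A ∈ P 0 := fun A => by
    obtain ⟨i, hi⟩ := hE A (Set.mem_univ A)
    rwa [Subsingleton.elim i 0] at hi
  exact hP 0 {0, 1} (hmem _) {1, 2} (hmem _) {0, 2} (hmem _)
    ⟨by decide, by decide, by decide, 1, 2, 0, by decide⟩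

theorem bergeDual_of_odd {n : ℕ} (hn : 6 ≤ n) (hodd : Odd n) :
    bergeDual n triangleGraph = 2 ^ (n - 2) := by
  refine le_antisymm (bergeDual_le (triCover_allSubsets_of_two_le (by omega))) ?_
  have h1 := two_pow_le_four_mul_bergeDual_add hn
  have h2 : (Finset.univ.filter fun A : Finset (Fin n) => 2 * A.card = n) = ∅ :=
    Finset.filter_eq_empty_iff.2 fun A _ h => by
      obtain ⟨j, rfl⟩ := hodd
      omega
  rw [h2, Finset.card_empty] at h1
  have h3 : 2 ^ n = 4 * 2 ^ (n - 2) := by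
    obtain ⟨m, rfl⟩ := Nat.exists_eq_add_of_le' (show 2 ≤ n by omega)
    rw [Nat.add_sub_cancel, pow_add]
    omega
  omega

theorem theorem1 :
    -- `k/2 - o(k) ≤ R_3(F, k) ≤ 3k/4 + o(k)`
    (∃ g h : ℕ → ℝ, g =o[atTop] (fun k : ℕ => (k : ℝ)) ∧ h =o[atTop] (fun k : ℕ => (k : ℝ)) ∧
      ∀ k : ℕ, 2 ≤ k →
        (k : ℝ) / 2 - g k ≤ (bergeRamsey 3 triangleGraph k : ℝ) ∧
        (bergeRamsey 3 triangleGraph k : ℝ) ≤ 3 * (k : ℝ) / 4 + h k) ∧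
    -- small Ramsey numbers
    (bergeRamsey 3 triangleGraph 2 = 5 ∧ bergeRamsey 3 triangleGraph 3 = 5 ∧
      bergeRamsey 3 triangleGraph 4 = 6 ∧ bergeRamsey 3 triangleGraph 5 = 7 ∧
      bergeRamsey 3 triangleGraph 6 = 8 ∧ bergeRamsey 3 triangleGraph 8 = 9) ∧
    -- `2^(n-2) (1 - o(1)) ≤ f(n, F) ≤ 2^(n-2)`
    ((∃ g : ℕ → ℝ, Tendsto g atTop (𝓝 0) ∧
        ∀ n : ℕ, 3 ≤ n →
          (2 : ℝ) ^ (n - 2) * (1 - g n) ≤ (bergeDual n triangleGraph : ℝ)) ∧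
      ∀ n : ℕ, 3 ≤ n → bergeDual n triangleGraph ≤ 2 ^ (n - 2)) ∧
    -- equality for every odd `n ≥ 3` except `n = 5`
    (∀ n : ℕ, 3 ≤ n → Odd n → (bergeDual n triangleGraph = 2 ^ (n - 2) ↔ n ≠ 5)) := by
  refine ⟨⟨fun k => 3 / 2 * (Nat.clog 2 k : ℝ), fun _ => 4, isLittleO_clog,
    (isLittleO_const_id_atTop (4 : ℝ)).comp_tendsto tendsto_natCast_atTop_atTop, ?_⟩,
    ⟨bergeRamsey_eq triCover_four_two (by norm_num) (by decide),
      bergeRamsey_eq triCover_four_two (by norm_num) (by decide),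
      bergeRamsey_eq triCover_five_four le_rfl (by decide),
      bergeRamsey_eq triCover_six_five le_rfl (by decide),
      bergeRamsey_eq triCover_seven_six le_rfl (by decide),
      bergeRamsey_eq triCover_eight_eight le_rfl (by decide)⟩,
    ⟨⟨fun n => 3 / √((n : ℝ) + 1), ?_, bergeDual_lower_bound⟩,
      fun n hn => bergeDual_le (triCover_allSubsets_of_two_le (by omega))⟩, ?_⟩
  · intro k _
    have h1 : (k : ℝ) ≤ 2 * bergeRamsey 3 triangleGraph k + 3 * Nat.clog 2 k := by
      exact_mod_cast half_le_bergeRamsey k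
    have h2 : (4 : ℝ) * bergeRamsey 3 triangleGraph k ≤ 3 * k + 16 := by
      have := bergeRamsey_le_three_quarters k
      exact_mod_cast (show 4 * bergeRamsey 3 triangleGraph k ≤ 3 * k + 16 by omega)
    constructor <;> linarith
  · exact tendsto_const_nhds.div_atTop (Real.tendsto_sqrt_atTop.comp
      (tendsto_atTop_add_const_right _ _ tendsto_natCast_atTop_atTop))
  · intro n hn hodd
    constructor
    · rintro h rfl
      have := bergeDual_le triCover_allSubsets_five
      omega
    · intro h5
      by_cases h6 : 6 ≤ n
      · exact bergeDual_of_odd h6 hodd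
      · obtain rfl : n = 3 := by
          obtain ⟨j, rfl⟩ := hodd
          omega
        exact bergeDual_three
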